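/- Fix an infinite label set and let $\mathcal G$ be the set of finite simple undirected graphs whose nodes carry distinct labels from it. Two graphs in $\mathcal G$ are *node neighbors* if one is obtained from the other by removing one node together with its incident edges; $d_{\mathrm{node}}$ is the induced path metric on $\mathcal G$. Fix an integer $D\ge 0$ and let $\mathcal G^D\subseteq\mathcal G$ be the set of graphs of maximum degree at most $D$. Let $\text{deg-list}(G)$ be the list of degrees of $G$ sorted in nonincreasing order. Finite real sequences are compared in the $\ell_1$ distance, the shorter one being padded with zeros. For $G=(V,E)\in\mathcal G$, let $\mathsf{FG}(G)$ be the directed flow network with a source $s$, a sink $t$ and two copies $v_\ell, v_r$ of each $v\in V$; its edges are $(s,v_\ell)$ and $(v_r,t)$ of capacity $D$ for every $v\in V$, and $(u_\ell,v_r)$ of capacity $1$ for every ordered pair $(u,v)$ of adjacent vertices. For a feasible $s$-$t$ flow $f$ in $\mathsf{FG}(G)$ put $$\Phi(f)=\sum_{v\in V}\Big(\big(D-f(s,v_\ell)\big)^2+\big(D-f(v_r,t)\big)^2\Big).$$ **Theorem.** For every $G\in\mathcal G$ the minimum of $\Phi$ over the feasible flows of $\mathsf{FG}(G)$ is attained,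 and all minimizers $f$ have the same values $f(s,v_\ell)$ and the same values $f(v_r,t)$, $v\in V$. Let $\hat f_D(G)$ be the list of the values $f(s,v_\ell)$, $v\in V$, of a minimizer $f$, sorted in nonincreasing order (the sorted list of the values $f(v_r,t)$ is the same). Then: 1. If $G\in\mathcal G^D$, then $\hat f_D(G)=\text{deg-list}(G)$. 2. For any two node neighbors $G_1,G_2\in\mathcal G$ (not necessarily in $\mathcal G^D$), $\|\hat f_D(G_1)-\hat f_D(G_2)\|_1\le 3D$. In other words, $\hat f_D$ is a Lipschitz extension of $\text{deg-list}$ from $\mathcal G^D$ to $\mathcal G$ of stretch $3/2$ with respect to $d_{\mathrm{node}}$ and the $\ell_1$ distance: $\text{deg-list}$ is $2D$-Lipschitz on $\mathcal G^D$, and for every $c>0$ for which $\text{deg-list}$ is $c$-Lipschitz on $\mathcal G^D$, the function $\hat f_D$ agrees with $\text{deg-list}$ on $\mathcal G^D$ and is $\tfrac32c$-Lipschitz on $\mathcal G$. -/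

import Mathlib

namespace DegreeExtension

/-! ### Flow networks -/

/-- A capacitated directed network on a node set `N`; a non-edge is a pair of capacity `0`. -/
structure FlowNetwork (N : Type*) where
  cap : N → N → ℝ
  source : N
  sink : N

/-- Feasible flows: nonnegative, within the capacities, and conserved at every node other than
the source and the sink. -/
structure FlowNetwork.IsFeasible {N : Type*} [Fintype N] (F : FlowNetwork N)
    (f : N → N → ℝ) : Prop where
  nonneg : ∀ a b, 0 ≤ f a b
  le_cap : ∀ a b, f a b ≤ F.cap a b
  conserve : ∀ a, a ≠ F.source → a ≠ F.sink → ∑ b, f b a = ∑ b, f a b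

/-- The node set of the flow graph of a graph on `V`: a source, a sink, and a left and a right
copy of each vertex. -/
inductive FlowNode (V : Type*) where
  | source : FlowNode V
  | sink : FlowNode V
  | left : V → FlowNode V
  | right : V → FlowNode V

/-- The nodes of the flow graph as a disjoint union (used only to see that they are finitely
many). -/
def FlowNode.equivSum (V : Type*) : Bool ⊕ (V ⊕ V) ≃ FlowNode V where
  toFun
    | .inl true => .source
    | .inl false => .sink
    | .inr (.inl v) => .left v
    | .inr (.inr v) => .right v
  invFun
    | .source => .inl true
    | .sink => .inl false
    | .left v => .inr (.inl v)
    | .right v => .inr (.inr v)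
  left_inv := by rintro ((_ | _) | (_ | _)) <;> rfl
  right_inv := by rintro (_ | _ | _ | _) <;> rfl

instance {V : Type*} [Fintype V] : Fintype (FlowNode V) :=
  Fintype.ofEquiv _ (FlowNode.equivSum V)

open scoped Classical in
/-- The flow graph of `G` with threshold `D`: edges of capacity `D` from the source to every left
copy and from every right copy to the sink, and edges of capacity `1` from `u` on the left to `v`
on the right for all adjacent `u`, `v`. -/
noncomputable def flowGraph {V : Type*} (D : ℕ) (G : SimpleGraph V) :
    FlowNetwork (FlowNode V) where
  cap
    | .source, .left _ => D
    | .right _, .sink => D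
    | .left u, .right v => if G.Adj u v then 1 else 0
    | _, _ => 0
  source := .source
  sink := .sink

/-- The flows on the edges leaving the source, indexed by the vertices. -/
def outFlow {V : Type*} (f : FlowNode V → FlowNode V → ℝ) : V → ℝ :=
  fun v => f .source (.left v)

/-- The flows on the edges entering the sink, indexed by the vertices. -/
def inFlow {V : Type*} (f : FlowNode V → FlowNode V → ℝ) : V → ℝ :=
  fun v => f (.right v) .sink

/-- The objective `Φ`. -/
noncomputable def phi {V : Type*} [Fintype V] (D : ℕ) (f : FlowNode V → FlowNode V → ℝ) : ℝ :=
  ∑ v, (((D : ℝ) - outFlow f v) ^ 2 + ((D : ℝ) - inFlow f v) ^ 2)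

/-- `f` minimizes `Φ` over all feasible flows in the flow graph of `G`. -/
def IsPhiOptimal {V : Type*} [Fintype V] (D : ℕ) (G : SimpleGraph V)
    (f : FlowNode V → FlowNode V → ℝ) : Prop :=
  (flowGraph D G).IsFeasible f ∧ ∀ g, (flowGraph D G).IsFeasible g → phi D f ≤ phi D g

/-! ### Finite real sequences -/

/-- The values of `x` sorted in nonincreasing order. -/
noncomputable def sortDesc {V : Type*} [Fintype V] (x : V → ℝ) : List ℝ :=
  (Finset.univ.val.map x).sort (· ≥ ·)

/-- The `ℓ₁` distance between finite sequences, the shorter one being padded with zeros. -/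
noncomputable def l1Dist (a b : List ℝ) : ℝ :=
  ∑ i ∈ Finset.range (max a.length b.length), |a.getD i 0 - b.getD i 0|

/-! ### Finite labeled graphs and the node metric -/

/-- Finite simple undirected graphs whose nodes carry distinct labels from `L`. -/
structure LabeledGraph (L : Type*) where
  verts : Finset L
  graph : SimpleGraph verts

/-- Remove the node `v` and its incident edges. -/
def LabeledGraph.deleteNode {L : Type*} [DecidableEq L] (G : LabeledGraph L) (v : L) :
    LabeledGraph L where
  verts := G.verts.erase v
  graph := G.graph.comap fun u => ⟨u.1, Finset.mem_of_mem_erase u.2⟩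

/-- One of the two graphs is obtained from the other by removing one node and its edges. -/
def NodeNeighbors {L : Type*} [DecidableEq L] (G₁ G₂ : LabeledGraph L) : Prop :=
  (∃ v ∈ G₂.verts, G₁ = G₂.deleteNode v) ∨ (∃ v ∈ G₁.verts, G₂ = G₁.deleteNode v)

/-- The (connected) graph on the set of all labeled graphs whose edges join node neighbors. -/
def nodeNeighborGraph (L : Type*) [DecidableEq L] : SimpleGraph (LabeledGraph L) where
  Adj := NodeNeighbors
  symm := ⟨fun _ _ h => Or.symm h⟩
  loopless := ⟨by
    have key : ∀ (G : LabeledGraph L), ∀ v ∈ G.verts, G ≠ G.deleteNode v := by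
      intro G v hv h
      have h' : G.verts = G.verts.erase v := congrArg LabeledGraph.verts h
      exact Finset.notMem_erase v G.verts (h' ▸ hv)
    rintro G (⟨v, hv, h⟩ | ⟨v, hv, h⟩) <;> exact key G v hv h⟩

/-- The node distance: the least number of node insertions and removals leading from one graph
to the other. -/
noncomputable def nodeDist {L : Type*} [DecidableEq L] (G₁ G₂ : LabeledGraph L) : ℝ :=
  ((nodeNeighborGraph L).dist G₁ G₂ : ℝ)

open scoped Classical in
/-- The degree list, sorted in nonincreasing order. -/
noncomputable def degList {L : Type*} (G : LabeledGraph L) : List ℝ :=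
  sortDesc fun v => (G.graph.degree v : ℝ)

open scoped Classical in
/-- The graphs of maximum degree at most `D`. -/
def boundedGraphs (L : Type*) (D : ℕ) : Set (LabeledGraph L) :=
  {G | ∀ v, G.graph.degree v ≤ D}

/-- The sorted list of the flows leaving the source in a `Φ`-optimal flow. -/
noncomputable def fHat {L : Type*} (D : ℕ) (G : LabeledGraph L) : List ℝ :=
  sortDesc (outFlow (Classical.epsilon (IsPhiOptimal D G.graph)))

/-! ### Lipschitz extensions for given distance functions -/

/-- `f` is `c`-Lipschitz on the set `S`. -/
def IsLipschitzOn {X Y : Type*} (dX : X → X → ℝ) (dY : Y → Y → ℝ) (c : ℝ) (S : Set X)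
    (f : X → Y) : Prop :=
  ∀ x ∈ S, ∀ x' ∈ S, dY (f x) (f x') ≤ c * dX x x'

/-- `f` is a Lipschitz extension with stretch `s` of the `c`-Lipschitz function `f'` from `S` to
the whole space `X` (only the values of `f'` on `S` matter). -/
structure IsLipschitzExtension {X Y : Type*} (dX : X → X → ℝ) (dY : Y → Y → ℝ) (S : Set X)
    (c s : ℝ) (f' f : X → Y) : Prop where
  pos : 0 < c
  one_le : 1 ≤ s
  base : IsLipschitzOn dX dY c S f'
  extends_base : ∀ x ∈ S, f x = f' x
  lipschitz : IsLipschitzOn dX dY (s * c) Set.univ f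

end DegreeExtension

open DegreeExtension

/-! By conservation a feasible flow is determined by its middle part: a nonnegative matrix bounded
entrywise by the adjacency matrix, with row and column sums at most `D`. `Φ` becomes the sum of the
squared row and column slacks. A minimizer exists by compactness, and its first-order conditions are
equivalent to having potentials `p`, `q` on rows and columns (`exists_isEquilibrium`): positive
slack determines a potential, and entries at neither bound join equal potentials.

The core is a monotone comparison, `IsEquilibrium.comparison`. When a row is added, every old row
sum can only decrease and every column sum can only increase. Its two-sided case is uniqueness; with
the symmetry of adjacency, uniqueness gives equal outflows and inflows. Since the new row carries at
most `D` and the grand total cannot drop, row sums change by at most `2D` in total and column sums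
by at most `D`. Adding a vertex adds a row and, by transposition, a column, so outflows change by at
most `2D + D = 3D`; sorting does not increase this.

On graphs of degree at most `D` the adjacency matrix is itself feasible and minimizes every slack at
once. Finally, `degList` has optimal constant `2D`: a common induced subgraph gives the upper bound,
and deleting a vertex of the complete graph on `D + 1` vertices gives the lower one. Hence `3D` is
stretch `3/2`. -/

namespace DegreeExtension

/-! ### Sorted sequences and the `ℓ₁` distance -/

/-- In a nonincreasing list the entries that reach a threshold form an initial segment. Positivity
of `t` makes the padding value `0` fall below the threshold. This turns comparisons of sorted
entries into comparisons of cardinalities. -/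
theorem lt_countP_iff_le_getD {t : ℝ} (ht : 0 < t) :
    ∀ {s : List ℝ}, s.Pairwise (· ≥ ·) → ∀ i : ℕ,
      i < s.countP (fun a => decide (t ≤ a)) ↔ t ≤ s.getD i 0
  | [], _, i => by simp [ht]
  | a :: s, hs, i => by
    rw [List.pairwise_cons] at hs
    have ih := lt_countP_iff_le_getD ht hs.2
    by_cases hta : t ≤ a
    · rw [List.countP_cons_of_pos (by simpa using hta)]
      cases i with
      | zero => simpa using hta
      | succ i => simpa using ih i
    · have h0 : ∀ b ∈ a :: s, ¬ t ≤ b := by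
        intro b hb
        rcases List.mem_cons.1 hb with rfl | hb
        · exact hta
        · exact fun h => hta (h.trans (hs.1 b hb))
      have hz : (a :: s).countP (fun a => decide (t ≤ a)) = 0 := by
        rw [List.countP_eq_zero]
        simpa using h0
      rw [hz]
      refine iff_of_false (Nat.not_lt_zero _) ?_
      by_cases hi : i < (a :: s).length
      · rw [List.getD_eq_getElem _ _ hi]
        exact h0 _ (List.getElem_mem hi)
      · rw [List.getD_eq_default _ _ (not_lt.1 hi)]
        exact not_le.2 ht

theorem sum_range_getD (s : List ℝ) {n : ℕ} (hn : s.length ≤ n) :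
    ∑ i ∈ Finset.range n, s.getD i 0 = s.sum := by
  induction s generalizing n with
  | nil => simp
  | cons a s ih =>
    obtain ⟨n, rfl⟩ : ∃ m, n = m + 1 := ⟨n - 1, by simp at hn; omega⟩
    rw [Finset.sum_range_succ', List.sum_cons, add_comm]
    simp only [List.getD_cons_zero, List.getD_cons_succ]
    rw [ih (by simpa using hn)]

theorem l1Dist_eq_sum_range (a b : List ℝ) {n : ℕ} (ha : a.length ≤ n) (hb : b.length ≤ n) :
    l1Dist a b = ∑ i ∈ Finset.range n, |a.getD i 0 - b.getD i 0| := by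
  refine Finset.sum_subset (Finset.range_mono (max_le ha hb)) fun i _ hi => ?_
  simp only [Finset.mem_range, not_lt, max_le_iff] at hi
  rw [List.getD_eq_default _ _ hi.1, List.getD_eq_default _ _ hi.2, sub_zero, abs_zero]

theorem l1Dist_comm (a b : List ℝ) : l1Dist a b = l1Dist b a := by
  unfold l1Dist
  rw [max_comm]
  exact Finset.sum_congr rfl fun i _ => abs_sub_comm _ _

theorem l1Dist_self (a : List ℝ) : l1Dist a a = 0 := by simp [l1Dist]

theorem l1Dist_triangle (a b c : List ℝ) : l1Dist a c ≤ l1Dist a b + l1Dist b c := by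
  set n := max a.length (max b.length c.length)
  have ha : a.length ≤ n := le_max_left _ _
  have hb : b.length ≤ n := (le_max_left _ _).trans (le_max_right _ _)
  have hc : c.length ≤ n := (le_max_right _ _).trans (le_max_right _ _)
  rw [l1Dist_eq_sum_range a c ha hc, l1Dist_eq_sum_range a b ha hb, l1Dist_eq_sum_range b c hb hc,
    ← Finset.sum_add_distrib]
  exact Finset.sum_le_sum fun i _ => abs_sub_le _ _ _

section SortDesc

variable {V W : Type*} [Fintype V] [Fintype W]

theorem sortDesc_pairwise (x : V → ℝ) : (sortDesc x).Pairwise (· ≥ ·) :=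
  Multiset.pairwise_sort _ _

theorem coe_sortDesc (x : V → ℝ) : (sortDesc x : Multiset ℝ) = Finset.univ.val.map x :=
  Multiset.sort_eq _ _

theorem sortDesc_sum (x : V → ℝ) : (sortDesc x).sum = ∑ v, x v := by
  rw [← Multiset.sum_coe, coe_sortDesc]
  rfl

theorem countP_sortDesc (x : V → ℝ) (t : ℝ) :
    (sortDesc x).countP (fun a => decide (t ≤ a)) = (Finset.univ.filter fun v => t ≤ x v).card := by
  rw [← Multiset.coe_countP, coe_sortDesc, Multiset.countP_map]
  rfl

theorem sortDesc_getD_nonneg {x : V → ℝ} (hx : ∀ v, 0 ≤ x v) (i : ℕ) :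
    0 ≤ (sortDesc x).getD i 0 := by
  by_cases hi : i < (sortDesc x).length
  · rw [List.getD_eq_getElem _ _ hi]
    have h : (sortDesc x)[i] ∈ (sortDesc x : Multiset ℝ) := List.getElem_mem hi
    rw [coe_sortDesc, Multiset.mem_map] at h
    obtain ⟨v, _, hv⟩ := h
    exact hv ▸ hx v
  · rw [List.getD_eq_default _ _ (not_lt.1 hi)]

theorem sortDesc_getD_mono {x : V → ℝ} {y : W → ℝ} {φ : V → W} (hφ : Function.Injective φ)
    (hxy : ∀ v, x v ≤ y (φ v)) (hy : ∀ w, 0 ≤ y w) (i : ℕ) :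
    (sortDesc x).getD i 0 ≤ (sortDesc y).getD i 0 := by
  rcases le_or_gt ((sortDesc x).getD i 0) 0 with h | h
  · exact h.trans (sortDesc_getD_nonneg hy i)
  -- The threshold is the `i`-th sorted entry of `x` itself; `φ` injects the indices where `x`
  -- reaches it into those where `y` does.
  · rw [← lt_countP_iff_le_getD h (sortDesc_pairwise y), countP_sortDesc]
    have := (lt_countP_iff_le_getD h (sortDesc_pairwise x) i).2 le_rfl
    rw [countP_sortDesc] at this
    refine this.trans_le (Finset.card_le_card_of_injOn φ ?_ hφ.injOn)
    intro v hv
    simp only [Finset.coe_filter, Finset.mem_univ, true_and, Set.mem_ofPred_eq] at hv ⊢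
    exact hv.trans (hxy v)

/-- Sorting is monotone, so the `ℓ₁` distance of a dominated pair is the difference of sums. -/
theorem l1Dist_sortDesc_of_le {x : V → ℝ} {y : W → ℝ} {φ : V → W} (hφ : Function.Injective φ)
    (hxy : ∀ v, x v ≤ y (φ v)) (hy : ∀ w, 0 ≤ y w) :
    l1Dist (sortDesc x) (sortDesc y) = ∑ w, y w - ∑ v, x v := by
  rw [l1Dist_eq_sum_range _ _ (le_max_left _ (sortDesc y).length) (le_max_right _ _),
    ← sortDesc_sum, ← sortDesc_sum,
    ← sum_range_getD (sortDesc x) (le_max_left _ (sortDesc y).length),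
    ← sum_range_getD (sortDesc y) (le_max_right (sortDesc x).length _), ← Finset.sum_sub_distrib]
  refine Finset.sum_congr rfl fun i _ => ?_
  rw [abs_sub_comm, abs_of_nonneg (sub_nonneg.2 (sortDesc_getD_mono hφ hxy hy i))]

/-- Sorting does not increase the `ℓ₁` distance. -/
theorem l1Dist_sortDesc_le {x y : V → ℝ} (hx : ∀ v, 0 ≤ x v) :
    l1Dist (sortDesc x) (sortDesc y) ≤ ∑ v, |x v - y v| := by
  have hz : ∀ v, 0 ≤ max (x v) (y v) := fun v => (hx v).trans (le_max_left _ _)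
  -- The pointwise maximum dominates both functions, so both distances to it are differences of
  -- sums, and these add up to the sum of `|x v - y v|`.
  refine (l1Dist_triangle _ (sortDesc fun v => max (x v) (y v)) _).trans ?_
  rw [l1Dist_comm _ (sortDesc y),
    l1Dist_sortDesc_of_le Function.injective_id (fun v => le_max_left (x v) (y v)) hz,
    l1Dist_sortDesc_of_le Function.injective_id (fun v => le_max_right (x v) (y v)) hz,
    ← Finset.sum_sub_distrib, ← Finset.sum_sub_distrib, ← Finset.sum_add_distrib]
  refine Finset.sum_le_sum fun v _ => ?_
  rcases le_total (x v) (y v) with h | h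
  · rw [max_eq_right h, abs_of_nonpos (by linarith)]
    linarith
  · rw [max_eq_left h, abs_of_nonneg (by linarith)]
    linarith

end SortDesc

/-! ### Bounded matrices minimizing the squared slacks -/

section Transport

variable {V : Type*} [Fintype V]

/-- Nonnegative matrices bounded by `c` entrywise and by `D` in all row and column sums. -/
structure IsTransport (D : ℝ) (c f : V → V → ℝ) : Prop where
  nonneg : ∀ u w, 0 ≤ f u w
  le_cap : ∀ u w, f u w ≤ c u w
  row_le : ∀ u, ∑ w, f u w ≤ D
  col_le : ∀ w, ∑ u, f u w ≤ D

/-- The sum of the squared slacks of the rows and columns. -/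
def slackCost (D : ℝ) (f : V → V → ℝ) : ℝ :=
  ∑ v, ((D - ∑ w, f v w) ^ 2 + (D - ∑ u, f u v) ^ 2)

/-- The first-order optimality conditions, with potentials `p` of the rows and `q` of the
columns. -/
structure IsEquilibrium (D : ℝ) (c f : V → V → ℝ) (p q : V → ℝ) : Prop
    extends IsTransport D c f where
  row_slack : ∀ u, D - ∑ w, f u w = max (p u) 0
  col_slack : ∀ w, D - ∑ u, f u w = max (-q w) 0
  le_of_lt_cap : ∀ u w, f u w < c u w → p u ≤ q w
  le_of_pos : ∀ u w, 0 < f u w → q w ≤ p u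

/-- The conditions are symmetric in rows and columns once the potentials are exchanged and negated,
so statements about rows transfer to columns. -/
theorem IsEquilibrium.transpose {D : ℝ} {c f : V → V → ℝ} {p q : V → ℝ}
    (h : IsEquilibrium D c f p q) :
    IsEquilibrium D (fun u w => c w u) (fun u w => f w u) (-q) (-p) where
  nonneg u w := h.nonneg w u
  le_cap u w := h.le_cap w u
  row_le := h.col_le
  col_le := h.row_le
  row_slack := h.col_slack
  col_slack u := by simpa using h.row_slack u
  le_of_lt_cap u w hlt := neg_le_neg (h.le_of_lt_cap w u hlt)
  le_of_pos u w hlt := neg_le_neg (h.le_of_pos w u hlt)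

theorem exists_forall_slackCost_le {D : ℝ} (hD : 0 ≤ D) {c : V → V → ℝ} (hc : ∀ u w, 0 ≤ c u w) :
    ∃ f, IsTransport D c f ∧ ∀ g, IsTransport D c g → slackCost D f ≤ slackCost D g := by
  have hset : {f | IsTransport D c f} = Set.Icc (0 : V → V → ℝ) c ∩
      ((⋂ u, {f : V → V → ℝ | ∑ w, f u w ≤ D}) ∩ ⋂ w, {f : V → V → ℝ | ∑ u, f u w ≤ D}) := by
    ext f
    simp only [Set.mem_ofPred_eq, Set.mem_inter_iff, Set.mem_iInter, Set.mem_Icc, Pi.le_def,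
      Pi.zero_apply]
    exact ⟨fun h => ⟨⟨h.nonneg, h.le_cap⟩, h.row_le, h.col_le⟩,
      fun h => ⟨h.1.1, h.1.2, h.2.1, h.2.2⟩⟩
  have hcomp : IsCompact {f | IsTransport D c f} := by
    rw [hset]
    refine isCompact_Icc.inter_right (IsClosed.inter ?_ ?_)
    · exact isClosed_iInter fun u => isClosed_le (by fun_prop) (by fun_prop)
    · exact isClosed_iInter fun u => isClosed_le (by fun_prop) (by fun_prop)
  have hne : {f | IsTransport D c f}.Nonempty :=
    ⟨fun _ _ => 0, fun _ _ => le_rfl, hc, by simpa using fun _ => hD, by simpa using fun _ => hD⟩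
  have hcont : Continuous (slackCost (V := V) D) := by
    unfold slackCost
    fun_prop
  obtain ⟨f, hf, hmin⟩ := hcomp.exists_isMinOn hne hcont.continuousOn
  exact ⟨f, hf, fun g hg => hmin hg⟩

/-- First-order optimality along a direction that leaves the feasible region at no active
constraint. -/
theorem sum_slack_mul_le_zero {D : ℝ} {c f d : V → V → ℝ} (hf : IsTransport D c f)
    (hmin : ∀ g, IsTransport D c g → slackCost D f ≤ slackCost D g)
    (hpos : ∀ u w, 0 < d u w → f u w < c u w) (hneg : ∀ u w, d u w < 0 → 0 < f u w)
    (hrow : ∀ u, 0 < ∑ w, d u w → ∑ w, f u w < D)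
    (hcol : ∀ w, 0 < ∑ u, d u w → ∑ u, f u w < D) :
    ∑ v, ((D - ∑ w, f v w) * ∑ w, d v w + (D - ∑ u, f u v) * ∑ u, d u v) ≤ 0 := by
  -- A linear constraint survives a small move unless it is tight and the move increases it.
  have step : ∀ {a b e : ℝ}, a ≤ b → (0 < e → a < b) →
      ∀ᶠ ε in nhdsWithin (0 : ℝ) (Set.Ioi 0), a + ε * e ≤ b := by
    intro a b e hab h
    rcases le_or_gt e 0 with he | he
    · filter_upwards [self_mem_nhdsWithin] with ε (hε : 0 < ε)
      nlinarith
    · have ht : Filter.Tendsto (fun ε : ℝ => a + ε * e) (nhdsWithin 0 (Set.Ioi 0)) (nhds a) := by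
        have : Continuous fun ε : ℝ => a + ε * e := by fun_prop
        simpa using (this.tendsto 0).mono_left nhdsWithin_le_nhds
      exact (ht.eventually_lt_const (h he)).mono fun _ => le_of_lt
  have sumr : ∀ (ε : ℝ) u, ∑ w, (f u w + ε * d u w) = ∑ w, f u w + ε * ∑ w, d u w := by
    intro ε u
    rw [Finset.sum_add_distrib, Finset.mul_sum]
  have sumc : ∀ (ε : ℝ) w, ∑ u, (f u w + ε * d u w) = ∑ u, f u w + ε * ∑ u, d u w := by
    intro ε w
    rw [Finset.sum_add_distrib, Finset.mul_sum]
  have hev : ∀ᶠ ε in nhdsWithin (0 : ℝ) (Set.Ioi 0),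
      IsTransport D c (fun u w => f u w + ε * d u w) := by
    have h1 : ∀ᶠ ε in nhdsWithin (0 : ℝ) (Set.Ioi 0), ∀ u w, f u w + ε * d u w ≤ c u w :=
      Filter.eventually_all.2 fun u => Filter.eventually_all.2 fun w =>
        step (hf.le_cap u w) (hpos u w)
    have h2 : ∀ᶠ ε in nhdsWithin (0 : ℝ) (Set.Ioi 0), ∀ u w, -f u w + ε * -d u w ≤ 0 :=
      Filter.eventually_all.2 fun u => Filter.eventually_all.2 fun w =>
        step (neg_nonpos.2 (hf.nonneg u w)) fun h => neg_lt_zero.2 (hneg u w (neg_pos.1 h))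
    have h3 : ∀ᶠ ε in nhdsWithin (0 : ℝ) (Set.Ioi 0), ∀ u, ∑ w, f u w + ε * ∑ w, d u w ≤ D :=
      Filter.eventually_all.2 fun u => step (hf.row_le u) (hrow u)
    have h4 : ∀ᶠ ε in nhdsWithin (0 : ℝ) (Set.Ioi 0), ∀ w, ∑ u, f u w + ε * ∑ u, d u w ≤ D :=
      Filter.eventually_all.2 fun w => step (hf.col_le w) (hcol w)
    filter_upwards [h1, h2, h3, h4] with ε h1 h2 h3 h4
    exact ⟨fun u w => by linarith [h2 u w], h1, fun u => by rw [sumr]; exact h3 u,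
      fun w => by rw [sumc]; exact h4 w⟩
  set A := ∑ v, ((D - ∑ w, f v w) * ∑ w, d v w + (D - ∑ u, f u v) * ∑ u, d u v) with hA
  set B := ∑ v, ((∑ w, d v w) ^ 2 + (∑ u, d u v) ^ 2) with hB
  -- Minimality of this quadratic at `ε = 0` gives `2 * A ≤ ε * B` for small `ε > 0`; letting `ε`
  -- tend to `0` yields `A ≤ 0`.
  have expand : ∀ ε : ℝ, slackCost D (fun u w => f u w + ε * d u w) =
      slackCost D f - 2 * ε * A + ε ^ 2 * B := by
    intro ε
    simp only [slackCost, sumr, sumc, hA, hB, Finset.mul_sum _ _ (2 * ε),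
      Finset.mul_sum _ _ (ε ^ 2)]
    rw [← Finset.sum_sub_distrib, ← Finset.sum_add_distrib]
    exact Finset.sum_congr rfl fun v _ => by ring
  have hle : ∀ᶠ ε in nhdsWithin (0 : ℝ) (Set.Ioi 0), 2 * A ≤ ε * B := by
    filter_upwards [hev, self_mem_nhdsWithin] with ε hε (hε0 : 0 < ε)
    have := hmin _ hε
    rw [expand] at this
    have h2 : ε * (2 * A) ≤ ε * (ε * B) := by nlinarith
    exact le_of_mul_le_mul_left h2 hε0
  have ht : Filter.Tendsto (fun ε : ℝ => ε * B) (nhdsWithin 0 (Set.Ioi 0)) (nhds 0) := by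
    have : Continuous fun ε : ℝ => ε * B := by fun_prop
    simpa using (this.tendsto 0).mono_left nhdsWithin_le_nhds
  linarith [ge_of_tendsto ht hle]

/-- Arcs of the residual network; `Sum.inl` are the rows and `Sum.inr` the columns. -/
inductive Residual (c f : V → V → ℝ) : V ⊕ V → V ⊕ V → Prop
  | forward {u w : V} : f u w < c u w → Residual c f (Sum.inl u) (Sum.inr w)
  | backward {u w : V} : 0 < f u w → Residual c f (Sum.inr w) (Sum.inl u)

open scoped Classical in
/-- A path in the residual network gives a direction that moves one unit from its start to its
end. -/
theorem exists_direction {c f : V → V → ℝ} {m n : V ⊕ V}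
    (h : Relation.ReflTransGen (Residual c f) m n) :
    ∃ d : V → V → ℝ, (∀ u w, 0 < d u w → f u w < c u w) ∧ (∀ u w, d u w < 0 → 0 < f u w) ∧
      (∀ u, ∑ w, d u w = (Pi.single m 1 - Pi.single n 1 : V ⊕ V → ℝ) (Sum.inl u)) ∧
      (∀ w, ∑ u, d u w = (Pi.single n 1 - Pi.single m 1 : V ⊕ V → ℝ) (Sum.inr w)) := by
  induction h with
  | refl => exact ⟨fun _ _ => 0, by simp, by simp, by simp, by simp⟩
  | @tail k n _ hkn ih =>
    obtain ⟨d, hp, hn, hr, hc⟩ := ih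
    obtain ⟨e, ep, en, er, ec⟩ : ∃ e : V → V → ℝ, (∀ u w, 0 < e u w → f u w < c u w) ∧
        (∀ u w, e u w < 0 → 0 < f u w) ∧
        (∀ u, ∑ w, e u w = (Pi.single k 1 - Pi.single n 1 : V ⊕ V → ℝ) (Sum.inl u)) ∧
        (∀ w, ∑ u, e u w = (Pi.single n 1 - Pi.single k 1 : V ⊕ V → ℝ) (Sum.inr w)) := by
      cases hkn with
      | @forward u w hlt =>
        refine ⟨fun a b => if a = u ∧ b = w then 1 else 0, ?_, ?_, ?_, ?_⟩
        · intro a b h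
          by_cases hab : a = u ∧ b = w
          · rwa [hab.1, hab.2]
          · simp [hab] at h
        · intro a b h
          dsimp only at h
          split_ifs at h <;> linarith
        · intro a
          by_cases ha : a = u <;> simp [ha]
        · intro b
          by_cases hb : b = w <;> simp [hb]
      | @backward u w hlt =>
        refine ⟨fun a b => if a = u ∧ b = w then -1 else 0, ?_, ?_, ?_, ?_⟩
        · intro a b h
          dsimp only at h
          split_ifs at h <;> linarith
        · intro a b h
          by_cases hab : a = u ∧ b = w
          · rwa [hab.1, hab.2]
          · simp [hab] at h
        · intro a
          by_cases ha : a = u <;> simp [ha]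
        · intro b
          by_cases hb : b = w <;> simp [hb]
    -- A sum has a strict sign only if a summand does, so adding directions keeps the sign
    -- conditions, and the contributions at the intermediate node `k` cancel.
    refine ⟨fun u w => d u w + e u w, ?_, ?_, ?_, ?_⟩
    · intro u w h
      rcases lt_or_ge 0 (d u w) with h1 | h1
      · exact hp u w h1
      · exact ep u w (by linarith)
    · intro u w h
      rcases lt_or_ge (d u w) 0 with h1 | h1
      · exact hn u w h1
      · exact en u w (by linarith)
    · intro u
      rw [Finset.sum_add_distrib, hr, er]
      simp only [Pi.sub_apply]
      ring
    · intro w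
      rw [Finset.sum_add_distrib, hc, ec]
      simp only [Pi.sub_apply]
      ring

/-- Along residual paths the marginal costs of an optimal solution are ordered. -/
theorem slack_le_of_residual {D : ℝ} {c f : V → V → ℝ} (hf : IsTransport D c f)
    (hmin : ∀ g, IsTransport D c g → slackCost D f ≤ slackCost D g) {m n : V ⊕ V}
    (h : Relation.ReflTransGen (Residual c f) m n)
    (hm : ∀ u, m = Sum.inl u → ∑ w, f u w < D) (hn : ∀ w, n = Sum.inr w → ∑ u, f u w < D) :
    Sum.elim (fun u => D - ∑ w, f u w) (fun w => -(D - ∑ u, f u w)) m ≤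
      Sum.elim (fun u => D - ∑ w, f u w) (fun w => -(D - ∑ u, f u w)) n := by
  classical
  obtain ⟨d, hp, hneg, hr, hc⟩ := exists_direction h
  have key := sum_slack_mul_le_zero hf hmin hp hneg
    (fun u hu => by
      refine hm u ?_
      by_contra hne
      rw [hr] at hu
      have h1 : (Pi.single m 1 : V ⊕ V → ℝ) (Sum.inl u) = 0 := by
        rw [Pi.single_apply, if_neg (Ne.symm hne)]
      have h2 : (0 : ℝ) ≤ (Pi.single n 1 : V ⊕ V → ℝ) (Sum.inl u) := by
        rw [Pi.single_apply]; split_ifs <;> norm_num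
      simp only [Pi.sub_apply] at hu
      linarith)
    (fun w hw => by
      refine hn w ?_
      by_contra hne
      rw [hc] at hw
      have h1 : (Pi.single n 1 : V ⊕ V → ℝ) (Sum.inr w) = 0 := by
        rw [Pi.single_apply, if_neg (Ne.symm hne)]
      have h2 : (0 : ℝ) ≤ (Pi.single m 1 : V ⊕ V → ℝ) (Sum.inr w) := by
        rw [Pi.single_apply]; split_ifs <;> norm_num
      simp only [Pi.sub_apply] at hw
      linarith)
  simp only [hr, hc, Pi.sub_apply, Finset.sum_add_distrib, mul_sub, Finset.sum_sub_distrib] at key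
  rcases m with m | m <;> rcases n with n | n <;>
    simp [Pi.single_apply] at key ⊢ <;> linarith

/-- The potentials are the multipliers of the entry bounds. They must be monotone along residual
arcs and lie in an interval at each node; `slack_le_of_residual` says these interval constraints are
compatible along residual paths. -/
theorem exists_isEquilibrium {D : ℝ} {c f : V → V → ℝ} (hf : IsTransport D c f)
    (hmin : ∀ g, IsTransport D c g → slackCost D f ≤ slackCost D g) :
    ∃ p q, IsEquilibrium D c f p q := by
  classical
  set a : V → ℝ := fun u => D - ∑ w, f u w with ha
  set b : V → ℝ := fun w => D - ∑ u, f u w with hb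
  have a0 : ∀ u, 0 ≤ a u := fun u => sub_nonneg.2 (hf.row_le u)
  have b0 : ∀ w, 0 ≤ b w := fun w => sub_nonneg.2 (hf.col_le w)
  have bD : ∀ w, b w ≤ D := fun w =>
    sub_le_self _ (Finset.sum_nonneg fun u _ => hf.nonneg u w)
  have aD : ∀ u, a u ≤ D := fun u =>
    sub_le_self _ (Finset.sum_nonneg fun w _ => hf.nonneg u w)
  -- The slack conditions fix the potential where the slack is positive; otherwise they only make it
  -- nonpositive on a row and nonnegative on a column. All slacks lie in `[0, D]`, so `-D` and `D`
  -- serve as the missing lower and upper bounds.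
  let lo : V ⊕ V → ℝ := Sum.elim (fun u => if 0 < a u then a u else -D) (fun w => -b w)
  let hi : V ⊕ V → ℝ := Sum.elim a (fun w => if 0 < b w then -b w else D)
  have lohi : ∀ m n, Relation.ReflTransGen (Residual c f) m n → lo m ≤ hi n := by
    intro m n h
    have key := slack_le_of_residual hf hmin h
    rcases m with u | w <;> rcases n with u' | w'
    · by_cases hu : 0 < a u
      · simp only [lo, hi, Sum.elim_inl, if_pos hu]
        refine key ?_ (by simp)
        rintro _ ⟨⟩
        exact sub_pos.1 hu
      · simp only [lo, hi, Sum.elim_inl, if_neg hu]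
        linarith [a0 u', a0 u, aD u]
    · by_cases hu : 0 < a u <;> by_cases hw : 0 < b w'
      · simp only [lo, hi, Sum.elim_inl, Sum.elim_inr, if_pos hu, if_pos hw]
        refine key ?_ ?_
        · rintro _ ⟨⟩
          exact sub_pos.1 hu
        · rintro _ ⟨⟩
          exact sub_pos.1 hw
      all_goals
        simp only [lo, hi, Sum.elim_inl, Sum.elim_inr, if_pos, hu, hw, if_false]
        linarith [aD u, bD w', a0 u, b0 w']
    · simp only [lo, hi, Sum.elim_inl, Sum.elim_inr]
      linarith [b0 w, a0 u']
    · by_cases hw : 0 < b w'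
      · simp only [lo, hi, Sum.elim_inr, if_pos hw]
        refine key (by simp) ?_
        rintro _ ⟨⟩
        exact sub_pos.1 hw
      · simp only [lo, hi, Sum.elim_inr, if_neg hw]
        linarith [b0 w, bD w]
  let R : V ⊕ V → Finset (V ⊕ V) := fun n =>
    Finset.univ.filter fun m => Relation.ReflTransGen (Residual c f) m n
  have hR : ∀ n, (R n).Nonempty := fun n =>
    ⟨n, Finset.mem_filter.2 ⟨Finset.mem_univ _, Relation.ReflTransGen.refl⟩⟩
  -- The least function above `lo` that is monotone along residual arcs; `lohi` keeps it below `hi`.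
  let P : V ⊕ V → ℝ := fun n => (R n).sup' (hR n) lo
  have loP : ∀ n, lo n ≤ P n := fun n =>
    Finset.le_sup' (s := R n) lo (Finset.mem_filter.2 ⟨Finset.mem_univ _, Relation.ReflTransGen.refl⟩)
  have Phi : ∀ n, P n ≤ hi n := fun n =>
    Finset.sup'_le _ _ fun m hm => lohi m n (Finset.mem_filter.1 hm).2
  have Pmono : ∀ m n, Residual c f m n → P m ≤ P n := by
    intro m n h
    refine Finset.sup'_le _ _ fun k hk => Finset.le_sup' lo ?_
    exact Finset.mem_filter.2 ⟨Finset.mem_univ _, (Finset.mem_filter.1 hk).2.tail h⟩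
  refine ⟨fun u => P (Sum.inl u), fun w => P (Sum.inr w), { hf with
    row_slack := fun u => ?_
    col_slack := fun w => ?_
    le_of_lt_cap := fun u w h => Pmono _ _ (.forward h)
    le_of_pos := fun u w h => Pmono _ _ (.backward h) }⟩
  · change a u = _
    have h1 := loP (Sum.inl u)
    have h2 := Phi (Sum.inl u)
    simp only [lo, hi, Sum.elim_inl] at h1 h2
    split_ifs at h1 with h
    · rw [max_eq_left (by linarith)]
      linarith
    · have h0 : a u = 0 := le_antisymm (not_lt.1 h) (a0 u)
      rw [max_eq_right (by linarith), h0]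
  · change b w = _
    have h1 := loP (Sum.inr w)
    have h2 := Phi (Sum.inr w)
    simp only [lo, hi, Sum.elim_inr] at h1 h2
    split_ifs at h2 with h
    · rw [max_eq_left (by linarith)]
      linarith
    · have h0 : b w = 0 := le_antisymm (not_lt.1 h) (b0 w)
      rw [max_eq_right (by linarith), h0]

/-- Comparison of two equilibria whose capacities agree in each row that does not vanish in the
first one. -/
theorem IsEquilibrium.comparison {D : ℝ} {c f c' f' : V → V → ℝ} {p q p' q' : V → ℝ}
    (h : IsEquilibrium D c f p q) (h' : IsEquilibrium D c' f' p' q')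
    (hc : ∀ u, c u = c' u ∨ c u = 0) :
    (∀ u, c u = c' u → ∑ w, f' u w ≤ ∑ w, f u w) ∧ (∀ w, ∑ u, f u w ≤ ∑ u, f' u w) := by
  classical
  -- Indicators of the rows with unchanged capacities and of the columns whose potential drops from
  -- the first equilibrium to the second. The change of `f` is tested against this cut.
  let S : V → ℝ := fun u => if c u = c' u ∧ p' u < p u then 1 else 0
  let T : V → ℝ := fun w => if q' w < q w then 1 else 0
  -- An entry changing in the wrong direction would be below capacity in one equilibrium and
  -- positive in the other, and the two resulting potential inequalities contradict membership in
  -- the cut. For a vanishing row, `f u w = 0 ≤ f' u w`.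
  have entry : ∀ u w, (S u - T w) * (f' u w - f u w) ≤ 0 := by
    intro u w
    have e1 := h.le_of_lt_cap u w
    have e2 := h.le_of_pos u w
    have e1' := h'.le_of_lt_cap u w
    have e2' := h'.le_of_pos u w
    have n1 := h.nonneg u w
    have n1' := h'.nonneg u w
    have k1 := h.le_cap u w
    have k1' := h'.le_cap u w
    by_cases hS : c u = c' u ∧ p' u < p u <;> by_cases hT : q' w < q w
    · simp [S, T, hS, hT]
    · have hcc : c u w = c' u w := congrFun hS.1 w
      have : f' u w ≤ f u w := by
        by_contra hlt
        rw [not_le] at hlt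
        linarith [e1 (by linarith), e2' (by linarith), hS.2]
      simp only [S, T, if_pos hS, if_neg hT]
      linarith
    · have : f u w ≤ f' u w := by
        rcases hc u with hcu | hcu
        · have hp : p u ≤ p' u := not_lt.1 fun hp => hS ⟨hcu, hp⟩
          have hcc : c u w = c' u w := congrFun hcu w
          by_contra hlt
          rw [not_le] at hlt
          linarith [e1' (by linarith), e2 (by linarith)]
        · have : c u w = 0 := congrFun hcu w
          linarith
      simp only [S, T, if_neg hS, if_pos hT]
      linarith
    · simp [S, T, hS, hT]
  have row0 : ∀ u, 0 ≤ S u * (∑ w, f' u w - ∑ w, f u w) := by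
    intro u
    by_cases hS : c u = c' u ∧ p' u < p u
    · have := max_le_max_right 0 hS.2.le
      simp only [S, if_pos hS]
      linarith [h.row_slack u, h'.row_slack u]
    · simp [S, hS]
  have col0 : ∀ w, 0 ≤ T w * (∑ u, f u w - ∑ u, f' u w) := by
    intro w
    by_cases hT : q' w < q w
    · have := max_le_max_right 0 (neg_le_neg hT.le)
      simp only [T, if_pos hT]
      linarith [h.col_slack w, h'.col_slack w]
    · simp [T, hT]
  -- Entrywise the total is nonpositive, while the slack formulas make every row and column term
  -- nonnegative. So all terms vanish: sums inside the cut agree, and outside it the potentials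
  -- already give the inequality.
  have total : ∑ u, S u * (∑ w, f' u w - ∑ w, f u w) + ∑ w, T w * (∑ u, f u w - ∑ u, f' u w) ≤ 0 := by
    have e1 : ∑ u, S u * (∑ w, f' u w - ∑ w, f u w) = ∑ u, ∑ w, S u * (f' u w - f u w) :=
      Finset.sum_congr rfl fun u _ => by rw [← Finset.sum_sub_distrib, Finset.mul_sum]
    have e2 : ∑ w, T w * (∑ u, f u w - ∑ u, f' u w) = ∑ u, ∑ w, T w * (f u w - f' u w) := by
      rw [Finset.sum_comm]
      exact Finset.sum_congr rfl fun u _ => by rw [← Finset.sum_sub_distrib, Finset.mul_sum]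
    rw [e1, e2, ← Finset.sum_add_distrib]
    refine Finset.sum_nonpos fun u _ => ?_
    rw [← Finset.sum_add_distrib]
    refine Finset.sum_nonpos fun w _ => ?_
    linarith [entry u w]
  have rows : ∑ u, S u * (∑ w, f' u w - ∑ w, f u w) = 0 := by
    linarith [Finset.sum_nonneg fun u (_ : u ∈ Finset.univ) => row0 u,
      Finset.sum_nonneg fun w (_ : w ∈ Finset.univ) => col0 w]
  have cols : ∑ w, T w * (∑ u, f u w - ∑ u, f' u w) = 0 := by
    linarith [Finset.sum_nonneg fun u (_ : u ∈ Finset.univ) => row0 u,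
      Finset.sum_nonneg fun w (_ : w ∈ Finset.univ) => col0 w]
  rw [Finset.sum_eq_zero_iff_of_nonneg fun u _ => row0 u] at rows
  rw [Finset.sum_eq_zero_iff_of_nonneg fun w _ => col0 w] at cols
  refine ⟨fun u hu => ?_, fun w => ?_⟩
  · by_cases hp : p' u < p u
    · have := rows u (Finset.mem_univ u)
      simp only [S, if_pos (And.intro hu hp), one_mul] at this
      linarith
    · have := max_le_max_right 0 (not_lt.1 hp)
      linarith [h.row_slack u, h'.row_slack u]
  · by_cases hq : q' w < q w
    · have := cols w (Finset.mem_univ w)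
      simp only [T, if_pos hq, one_mul] at this
      linarith
    · have := max_le_max_right 0 (neg_le_neg (not_lt.1 hq))
      linarith [h.col_slack w, h'.col_slack w]

theorem IsEquilibrium.unique {D : ℝ} {c f f' : V → V → ℝ} {p q p' q' : V → ℝ}
    (h : IsEquilibrium D c f p q) (h' : IsEquilibrium D c f' p' q') :
    (∀ u, ∑ w, f u w = ∑ w, f' u w) ∧ (∀ w, ∑ u, f u w = ∑ u, f' u w) := by
  have h1 := h.comparison h' fun _ => Or.inl rfl
  have h2 := h'.comparison h fun _ => Or.inl rfl
  exact ⟨fun u => le_antisymm (h2.1 u rfl) (h1.1 u rfl), fun w => le_antisymm (h1.2 w) (h2.2 w)⟩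

/-- Adding a row changes the other row sums by at most `D` in total, and likewise the column
sums. -/
theorem IsEquilibrium.sum_abs_sub_le [DecidableEq V] {D : ℝ} {c f c' f' : V → V → ℝ}
    {p q p' q' : V → ℝ} (h : IsEquilibrium D c f p q) (h' : IsEquilibrium D c' f' p' q') (v : V)
    (hv : c v = 0) (hc : ∀ u, u ≠ v → c u = c' u) :
    ∑ u, |∑ w, f u w - ∑ w, f' u w| ≤ 2 * D ∧ ∑ w, |∑ u, f u w - ∑ u, f' u w| ≤ D := by
  have hcmp := h.comparison h' fun u =>
    (em (u = v)).elim (fun e => Or.inr (e ▸ hv)) fun e => Or.inl (hc u e)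
  have hfv : ∑ w, f v w = 0 := Finset.sum_eq_zero fun w _ =>
    le_antisymm ((h.le_cap v w).trans (congrFun hv w).le) (h.nonneg v w)
  have hfv' : 0 ≤ ∑ w, f' v w := Finset.sum_nonneg fun w _ => h'.nonneg v w
  have hrow : ∑ u, |∑ w, f u w - ∑ w, f' u w| =
      ∑ w, f' v w + ∑ u ∈ Finset.univ.erase v, (∑ w, f u w - ∑ w, f' u w) := by
    rw [← Finset.add_sum_erase _ _ (Finset.mem_univ v), hfv, zero_sub, abs_neg, abs_of_nonneg hfv']
    congr 1
    refine Finset.sum_congr rfl fun u hu => abs_of_nonneg (sub_nonneg.2 ?_)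
    exact hcmp.1 u (hc u (Finset.ne_of_mem_erase hu))
  have hcol : ∑ w, |∑ u, f u w - ∑ u, f' u w| = ∑ w, ∑ u, f' u w - ∑ w, ∑ u, f u w := by
    rw [← Finset.sum_sub_distrib]
    refine Finset.sum_congr rfl fun w _ => ?_
    rw [abs_sub_comm, abs_of_nonneg (sub_nonneg.2 (hcmp.2 w))]
  have hoff : 0 ≤ ∑ u ∈ Finset.univ.erase v, (∑ w, f u w - ∑ w, f' u w) :=
    Finset.sum_nonneg fun u hu => sub_nonneg.2 (hcmp.1 u (hc u (Finset.ne_of_mem_erase hu)))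
  have hcol0 : 0 ≤ ∑ w, |∑ u, f u w - ∑ u, f' u w| := Finset.sum_nonneg fun _ _ => abs_nonneg _
  have e1 := Finset.add_sum_erase Finset.univ (fun u => ∑ w, f u w) (Finset.mem_univ v)
  have e2 := Finset.add_sum_erase Finset.univ (fun u => ∑ w, f' u w) (Finset.mem_univ v)
  have c1 : ∑ w, ∑ u, f u w = ∑ u, ∑ w, f u w := Finset.sum_comm
  have c2 : ∑ w, ∑ u, f' u w = ∑ u, ∑ w, f' u w := Finset.sum_comm
  rw [Finset.sum_sub_distrib] at hrow hoff
  have := h'.row_le v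
  constructor <;> linarith

/-- Adding a row and a column with the same index changes the row sums by at most `3 * D` in
total. -/
theorem IsEquilibrium.sum_abs_row_sub_le [DecidableEq V] {D : ℝ} (hD : 0 ≤ D)
    {c f c' f' : V → V → ℝ} {p q p' q' : V → ℝ} (h : IsEquilibrium D c f p q)
    (h' : IsEquilibrium D c' f' p' q') (v : V) (hrow : c v = 0) (hcol : ∀ u, c u v = 0)
    (hc : ∀ u w, u ≠ v → w ≠ v → c u w = c' u w) (hc' : ∀ u w, 0 ≤ c' u w) :
    ∑ u, |∑ w, f u w - ∑ w, f' u w| ≤ 3 * D := by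
  -- The intermediate capacities already have column `v` but not row `v`. Restoring the row costs `2
  -- * D`; adding the column costs `D`, by the column estimate for the transposes.
  let m : V → V → ℝ := fun u w => if u = v then 0 else c' u w
  obtain ⟨g, hg, hgmin⟩ := exists_forall_slackCost_le hD (c := m) fun u w => by
    dsimp only [m]
    split_ifs
    exacts [le_rfl, hc' u w]
  obtain ⟨r, s, hg⟩ := exists_isEquilibrium hg hgmin
  have h1 := (hg.sum_abs_sub_le h' v (funext fun w => by simp [m])
    fun u hu => funext fun w => by simp [m, hu]).1
  have h2 := (h.transpose.sum_abs_sub_le hg.transpose v (funext hcol) fun w hw => funext fun u => by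
    by_cases hu : u = v
    · subst hu
      simp [m, hrow]
    · simp [m, hu, hc u w hu hw]).2
  calc ∑ u, |∑ w, f u w - ∑ w, f' u w|
      ≤ ∑ u, (|∑ w, f u w - ∑ w, g u w| + |∑ w, g u w - ∑ w, f' u w|) :=
        Finset.sum_le_sum fun u _ => abs_sub_le _ _ _
    _ ≤ 3 * D := by
        rw [Finset.sum_add_distrib]
        linarith

end Transport

/-! ### From flows to matrices -/

theorem FlowNode.sum_eq {V : Type*} [Fintype V] (g : FlowNode V → ℝ) :
    ∑ n, g n = g .source + g .sink + ∑ v, g (.left v) + ∑ v, g (.right v) := by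
  rw [← (FlowNode.equivSum V).sum_comp g, Fintype.sum_sum_type, Fintype.sum_sum_type,
    Fintype.sum_bool, ← add_assoc]
  rfl

open scoped Classical in
/-- The adjacency indicator, as a capacity matrix. -/
noncomputable def adjCap {V : Type*} (G : SimpleGraph V) : V → V → ℝ := fun u w => if G.Adj u w then 1 else 0

theorem adjCap_nonneg {V : Type*} (G : SimpleGraph V) (u w : V) : 0 ≤ adjCap G u w := by
  unfold adjCap
  split_ifs <;> norm_num

theorem adjCap_comm {V : Type*} (G : SimpleGraph V) (u w : V) : adjCap G u w = adjCap G w u := by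
  classical exact if_congr (G.adj_comm u w) rfl rfl

section Flow

variable {V : Type*} [Fintype V]

/-- The part of a flow that runs between the two copies of the vertex set. -/
def middle (f : FlowNode V → FlowNode V → ℝ) : V → V → ℝ := fun u w => f (.left u) (.right w)

/-- The flow with a prescribed middle part. -/
def flowOfMiddle (m : V → V → ℝ) : FlowNode V → FlowNode V → ℝ
  | .source, .left v => ∑ w, m v w
  | .right v, .sink => ∑ u, m u v
  | .left u, .right w => m u w
  | _, _ => 0

variable {D : ℕ} {G : SimpleGraph V} {f : FlowNode V → FlowNode V → ℝ}

theorem outFlow_eq (h : (flowGraph D G).IsFeasible f) (v : V) :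
    outFlow f v = ∑ w, middle f v w := by
  have hz : ∀ a b, (flowGraph D G).cap a b = 0 → f a b = 0 := fun a b hab =>
    le_antisymm (hab ▸ h.le_cap a b) (h.nonneg a b)
  have hcons := h.conserve (.left v) nofun nofun
  rw [FlowNode.sum_eq, FlowNode.sum_eq, hz .sink _ rfl, hz _ .source rfl, hz _ .sink rfl,
    Finset.sum_eq_zero fun u _ => hz (.left u) (.left v) rfl,
    Finset.sum_eq_zero fun u _ => hz (.right u) (.left v) rfl,
    Finset.sum_eq_zero fun u _ => hz (.left v) (.left u) rfl] at hcons
  simpa [outFlow, middle] using hcons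

theorem inFlow_eq (h : (flowGraph D G).IsFeasible f) (v : V) :
    inFlow f v = ∑ u, middle f u v := by
  have hz : ∀ a b, (flowGraph D G).cap a b = 0 → f a b = 0 := fun a b hab =>
    le_antisymm (hab ▸ h.le_cap a b) (h.nonneg a b)
  have hcons := h.conserve (.right v) nofun nofun
  rw [FlowNode.sum_eq, FlowNode.sum_eq, hz .sink _ rfl, hz .source _ rfl, hz _ .source rfl,
    Finset.sum_eq_zero fun u _ => hz (.right u) (.right v) rfl,
    Finset.sum_eq_zero fun u _ => hz (.right v) (.left u) rfl,
    Finset.sum_eq_zero fun u _ => hz (.right v) (.right u) rfl] at hcons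
  simpa [inFlow, middle] using hcons.symm

theorem isTransport_middle (h : (flowGraph D G).IsFeasible f) :
    IsTransport D (adjCap G) (middle f) where
  nonneg _ _ := h.nonneg _ _
  le_cap u w := h.le_cap (.left u) (.right w)
  row_le u := outFlow_eq h u ▸ h.le_cap .source (.left u)
  col_le w := inFlow_eq h w ▸ h.le_cap (.right w) .sink

theorem phi_eq_slackCost (h : (flowGraph D G).IsFeasible f) :
    phi D f = slackCost D (middle f) := by
  simp only [phi, slackCost, outFlow_eq h, inFlow_eq h]

theorem isFeasible_flowOfMiddle {m : V → V → ℝ} (h : IsTransport D (adjCap G) m) :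
    (flowGraph D G).IsFeasible (flowOfMiddle m) where
  nonneg a b := by
    rcases a with _ | _ | u | u <;> rcases b with _ | _ | w | w <;> try exact le_rfl
    · exact Finset.sum_nonneg fun _ _ => h.nonneg _ _
    · exact h.nonneg _ _
    · exact Finset.sum_nonneg fun _ _ => h.nonneg _ _
  le_cap a b := by
    rcases a with _ | _ | u | u <;> rcases b with _ | _ | w | w <;> try exact le_rfl
    · exact h.row_le w
    · exact h.le_cap u w
    · exact h.col_le u
  conserve a hs ht := by
    rcases a with _ | _ | u | u
    · exact absurd rfl hs
    · exact absurd rfl ht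
    · simp [FlowNode.sum_eq, flowOfMiddle]
    · simp [FlowNode.sum_eq, flowOfMiddle]

theorem middle_flowOfMiddle (m : V → V → ℝ) : middle (flowOfMiddle m) = m := rfl

theorem exists_isPhiOptimal (D : ℕ) (G : SimpleGraph V) : ∃ f, IsPhiOptimal D G f := by
  obtain ⟨m, hm, hmin⟩ := exists_forall_slackCost_le (Nat.cast_nonneg D) (adjCap_nonneg G)
  refine ⟨flowOfMiddle m, isFeasible_flowOfMiddle hm, fun g hg => ?_⟩
  rw [phi_eq_slackCost (isFeasible_flowOfMiddle hm), phi_eq_slackCost hg]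
  exact hmin _ (isTransport_middle hg)

theorem IsPhiOptimal.exists_isEquilibrium (h : IsPhiOptimal D G f) :
    ∃ p q, IsEquilibrium D (adjCap G) (middle f) p q := by
  refine DegreeExtension.exists_isEquilibrium (isTransport_middle h.1) fun g hg => ?_
  rw [← phi_eq_slackCost h.1]
  have := h.2 _ (isFeasible_flowOfMiddle hg)
  rwa [phi_eq_slackCost (isFeasible_flowOfMiddle hg)] at this

theorem IsPhiOptimal.unique {g : FlowNode V → FlowNode V → ℝ} (hf : IsPhiOptimal D G f)
    (hg : IsPhiOptimal D G g) : outFlow f = outFlow g ∧ inFlow f = inFlow g := by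
  obtain ⟨p, q, hp⟩ := hf.exists_isEquilibrium
  obtain ⟨p', q', hp'⟩ := hg.exists_isEquilibrium
  have := hp.unique hp'
  constructor <;> funext v
  · rw [outFlow_eq hf.1, outFlow_eq hg.1, this.1]
  · rw [inFlow_eq hf.1, inFlow_eq hg.1, this.2]

/-- Adjacency is symmetric, so the transpose of an equilibrium is an equilibrium for the same
capacities, and uniqueness identifies row sums with column sums. -/
theorem IsPhiOptimal.outFlow_eq_inFlow (hf : IsPhiOptimal D G f) : outFlow f = inFlow f := by
  obtain ⟨p, q, hp⟩ := hf.exists_isEquilibrium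
  have ht := hp.transpose
  have hsymm : (fun u w => adjCap G w u) = adjCap G := funext₂ fun u w => adjCap_comm G w u
  rw [hsymm] at ht
  funext v
  rw [outFlow_eq hf.1, inFlow_eq hf.1, (hp.unique ht).1]

open scoped Classical in
theorem natCast_degree_eq_sum (G : SimpleGraph V) (u : V) :
    (G.degree u : ℝ) = ∑ w, adjCap G u w := by
  simp only [adjCap, Finset.sum_boole]
  rw [← G.card_neighborFinset_eq_degree, G.neighborFinset_eq_filter]

end Flow

/-! ### The extension `fHat` and its values on bounded graphs -/

section Labeled

variable {L : Type*}

theorem fHat_eq {D : ℕ} {G : LabeledGraph L} {f : FlowNode G.verts → FlowNode G.verts → ℝ}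
    (hf : IsPhiOptimal D G.graph f) : fHat D G = sortDesc (outFlow f) := by
  have h := Classical.epsilon_spec (exists_isPhiOptimal D G.graph)
  rw [fHat, (h.unique hf).1]

theorem exists_isEquilibrium_fHat (D : ℕ) (G : LabeledGraph L) :
    ∃ m p q, IsEquilibrium D (adjCap G.graph) m p q ∧ fHat D G = sortDesc fun v => ∑ w, m v w := by
  obtain ⟨f, hf⟩ := exists_isPhiOptimal D G.graph
  obtain ⟨p, q, h⟩ := hf.exists_isEquilibrium
  refine ⟨middle f, p, q, h, ?_⟩
  rw [fHat_eq hf]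
  exact congrArg sortDesc (funext (outFlow_eq hf.1))

theorem degList_eq (G : LabeledGraph L) : degList G = sortDesc fun u => ∑ w, adjCap G.graph u w :=
  congrArg sortDesc (funext (natCast_degree_eq_sum G.graph))

theorem sum_adjCap_le {D : ℕ} {G : LabeledGraph L} (hG : G ∈ boundedGraphs L D) (u : G.verts) :
    ∑ w, adjCap G.graph u w ≤ D := by
  rw [← natCast_degree_eq_sum]
  exact_mod_cast hG u

/-- The degree bound makes the adjacency matrix feasible. It dominates every feasible matrix
entrywise, so it minimizes each nonnegative slack separately. -/
theorem fHat_eq_degList {D : ℕ} {G : LabeledGraph L} (hG : G ∈ boundedGraphs L D) :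
    fHat D G = degList G := by
  have hcol : ∀ w, ∑ u, adjCap G.graph u w = ∑ u, adjCap G.graph w u := fun w =>
    Finset.sum_congr rfl fun u _ => adjCap_comm _ _ _
  have ht : IsTransport D (adjCap G.graph) (adjCap G.graph) :=
    ⟨adjCap_nonneg _, fun _ _ => le_rfl, sum_adjCap_le hG,
      fun w => (hcol w).trans_le (sum_adjCap_le hG w)⟩
  have hfeas := isFeasible_flowOfMiddle ht
  have hopt : IsPhiOptimal D G.graph (flowOfMiddle (adjCap G.graph)) := by
    refine ⟨hfeas, fun g hg => ?_⟩
    have hg' := isTransport_middle hg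
    rw [phi_eq_slackCost hfeas, phi_eq_slackCost hg, middle_flowOfMiddle]
    refine Finset.sum_le_sum fun v _ => add_le_add ?_ ?_
    · exact pow_le_pow_left₀ (sub_nonneg.2 (ht.row_le v))
        (sub_le_sub_left (Finset.sum_le_sum fun w _ => hg'.le_cap v w) _) 2
    · exact pow_le_pow_left₀ (sub_nonneg.2 (ht.col_le v))
        (sub_le_sub_left (Finset.sum_le_sum fun u _ => hg'.le_cap u v) _) 2
  rw [fHat_eq hopt, degList_eq]
  exact congrArg sortDesc (funext (outFlow_eq hfeas))

end Labeled

/-! ### Padding with an isolated vertex -/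

section Extend

variable {V W : Type*}

/-- Extension of a matrix by zero along a map of the index sets. -/
noncomputable def extendMatrix (φ : V → W) (m : V → V → ℝ) : W → W → ℝ :=
  Function.extend φ (fun a => Function.extend φ (m a) 0) 0

theorem extendMatrix_apply {φ : V → W} (hφ : Function.Injective φ) (m : V → V → ℝ) (a b : V) :
    extendMatrix φ m (φ a) (φ b) = m a b := by
  rw [extendMatrix, hφ.extend_apply, hφ.extend_apply]

theorem extendMatrix_left {φ : V → W} {v : W} (hv : ∀ a, φ a ≠ v) (m : V → V → ℝ) :
    extendMatrix φ m v = 0 :=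
  Function.extend_apply' _ _ _ fun ⟨a, ha⟩ => hv a ha

theorem extendMatrix_right {φ : V → W} (hφ : Function.Injective φ) {v : W} (hv : ∀ a, φ a ≠ v)
    (m : V → V → ℝ) (u : W) : extendMatrix φ m u v = 0 := by
  by_cases hu : ∃ a, φ a = u
  · obtain ⟨a, rfl⟩ := hu
    rw [extendMatrix, hφ.extend_apply, Function.extend_apply' _ _ _ fun ⟨a, ha⟩ => hv a ha]
    rfl
  · rw [extendMatrix, Function.extend_apply' _ _ _ hu]
    rfl

variable [Fintype V] [Fintype W]

theorem sum_eq_add_sum_comp {φ : V → W} (hφ : Function.Injective φ) {v : W}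
    (hv : ∀ a, φ a ≠ v) (hsurj : ∀ w, w ≠ v → ∃ a, φ a = w) (g : W → ℝ) :
    ∑ w, g w = g v + ∑ a, g (φ a) := by
  classical
  rw [← Finset.add_sum_erase _ _ (Finset.mem_univ v)]
  congr 1
  have : Finset.univ.erase v = Finset.univ.map ⟨φ, hφ⟩ := by
    ext w
    simp only [Finset.mem_erase, Finset.mem_univ, and_true, Finset.mem_map, true_and,
      Function.Embedding.coeFn_mk]
    exact ⟨hsurj w, fun ⟨a, ha⟩ => ha ▸ hv a⟩
  rw [this, Finset.sum_map]
  rfl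

/-- Adding an isolated vertex to an equilibrium. -/
theorem IsEquilibrium.extend {D : ℝ} (hD : 0 ≤ D) {c m : V → V → ℝ} {p q : V → ℝ}
    (h : IsEquilibrium D c m p q) {φ : V → W} (hφ : Function.Injective φ) {v : W}
    -- The new row and column are zero and have full slack `D`, which forces the potentials `D` and
    -- `-D` when `D > 0`. With zero capacity, the new vertex has no residual arcs to constrain them.
    (hv : ∀ a, φ a ≠ v) (hsurj : ∀ w, w ≠ v → ∃ a, φ a = w) :
    IsEquilibrium D (extendMatrix φ c) (extendMatrix φ m) (Function.extend φ p fun _ => D)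
      (Function.extend φ q fun _ => -D) := by
  have hl := fun n : V → V → ℝ => extendMatrix_left hv n
  have hr := fun n : V → V → ℝ => extendMatrix_right hφ hv n
  have cases : ∀ {P : W → Prop}, P v → (∀ a, P (φ a)) → ∀ w, P w := by
    intro P h1 h2 w
    by_cases hw : w = v
    · exact hw ▸ h1
    · obtain ⟨a, rfl⟩ := hsurj w hw
      exact h2 a
  have hrow : ∀ a, ∑ w, extendMatrix φ m (φ a) w = ∑ b, m a b := fun a => by
    rw [sum_eq_add_sum_comp hφ hv hsurj, hr, zero_add]
    simp only [extendMatrix_apply hφ]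
  have hcol : ∀ a, ∑ u, extendMatrix φ m u (φ a) = ∑ b, m b a := fun a => by
    rw [sum_eq_add_sum_comp hφ hv hsurj, hl, Pi.zero_apply, zero_add]
    simp only [extendMatrix_apply hφ]
  have hrow0 : ∑ w, extendMatrix φ m v w = 0 := by simp [hl]
  have hcol0 : ∑ u, extendMatrix φ m u v = 0 := by simp [hr]
  have hv' : ¬ ∃ a, φ a = v := fun ⟨a, ha⟩ => hv a ha
  constructor
  · constructor
    · refine cases (fun w => by simp [hl]) fun a => cases (by simp [hr]) fun b => ?_
      rw [extendMatrix_apply hφ]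
      exact h.nonneg a b
    · refine cases (fun w => by simp [hl]) fun a => cases (by simp [hr]) fun b => ?_
      rw [extendMatrix_apply hφ, extendMatrix_apply hφ]
      exact h.le_cap a b
    · exact cases (hrow0 ▸ hD) fun a => hrow a ▸ h.row_le a
    · exact cases (hcol0 ▸ hD) fun a => hcol a ▸ h.col_le a
  · refine cases ?_ fun a => ?_
    · rw [hrow0, Function.extend_apply' _ _ _ hv', sub_zero, max_eq_left hD]
    · rw [hrow, hφ.extend_apply, h.row_slack]
  · refine cases ?_ fun a => ?_
    · rw [hcol0, Function.extend_apply' _ _ _ hv', sub_zero, neg_neg, max_eq_left hD]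
    · rw [hcol, hφ.extend_apply, h.col_slack]
  · refine cases (fun w => by simp [hl]) fun a => cases (by simp [hr]) fun b => ?_
    simp only [extendMatrix_apply hφ, hφ.extend_apply]
    exact h.le_of_lt_cap a b
  · refine cases (fun w => by simp [hl]) fun a => cases (by simp [hr]) fun b => ?_
    simp only [extendMatrix_apply hφ, hφ.extend_apply]
    exact h.le_of_pos a b

end Extend

/-! ### Sensitivity under node removal and along walks -/

section Sensitivity

variable {L : Type*} [DecidableEq L]

theorem l1Dist_fHat_deleteNode_le (D : ℕ) (G : LabeledGraph L) {v : L} (hv : v ∈ G.verts) :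
    l1Dist (fHat D (G.deleteNode v)) (fHat D G) ≤ 3 * (D : ℝ) := by
  obtain ⟨m, p, q, hm, hmf⟩ := exists_isEquilibrium_fHat D (G.deleteNode v)
  obtain ⟨m', p', q', hm', hmf'⟩ := exists_isEquilibrium_fHat D G
  let φ : (G.deleteNode v).verts → G.verts := fun u => ⟨u.1, Finset.mem_of_mem_erase u.2⟩
  have hφ : Function.Injective φ := fun a b hab => Subtype.ext (Subtype.mk.inj hab)
  have hφv : ∀ a, φ a ≠ ⟨v, hv⟩ := fun a ha =>
    Finset.ne_of_mem_erase a.2 (congrArg Subtype.val ha)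
  have hsurj : ∀ w, w ≠ ⟨v, hv⟩ → ∃ a, φ a = w := fun w hw =>
    ⟨⟨w.1, Finset.mem_erase.2 ⟨fun e => hw (Subtype.ext e), w.2⟩⟩, rfl⟩
  have hD : (0 : ℝ) ≤ D := Nat.cast_nonneg D
  have he := hm.extend hD hφ hφv hsurj
  have hrow : ∀ a, ∑ w, extendMatrix φ m (φ a) w = ∑ b, m a b := fun a => by
    rw [sum_eq_add_sum_comp hφ hφv hsurj, extendMatrix_right hφ hφv, zero_add]
    simp only [extendMatrix_apply hφ]
  -- The isolated vertex only appends a zero to the sorted list, which padding ignores. Both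
  -- equilibria then live on the same index set.
  have hpad : l1Dist (sortDesc fun a => ∑ b, m a b)
      (sortDesc fun u => ∑ w, extendMatrix φ m u w) = 0 := by
    rw [l1Dist_sortDesc_of_le hφ (fun a => (hrow a).ge)
      fun u => Finset.sum_nonneg fun w _ => he.nonneg u w,
      sum_eq_add_sum_comp hφ hφv hsurj, extendMatrix_left hφv]
    simp only [hrow]
    simp
  rw [hmf, hmf']
  refine (l1Dist_triangle _ (sortDesc fun u => ∑ w, extendMatrix φ m u w) _).trans ?_
  rw [hpad, zero_add]
  refine (l1Dist_sortDesc_le fun u => Finset.sum_nonneg fun w _ => he.nonneg u w).trans ?_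
  refine he.sum_abs_row_sub_le hD hm' ⟨v, hv⟩ (extendMatrix_left hφv _)
    (extendMatrix_right hφ hφv _) ?_ (adjCap_nonneg _)
  intro u w hu hw
  obtain ⟨a, rfl⟩ := hsurj u hu
  obtain ⟨b, rfl⟩ := hsurj w hw
  rw [extendMatrix_apply hφ]
  rfl

theorem l1Dist_fHat_le (D : ℕ) {G₁ G₂ : LabeledGraph L} (h : NodeNeighbors G₁ G₂) :
    l1Dist (fHat D G₁) (fHat D G₂) ≤ 3 * (D : ℝ) := by
  rcases h with ⟨v, hv, rfl⟩ | ⟨v, hv, rfl⟩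
  · exact l1Dist_fHat_deleteNode_le D G₂ hv
  · rw [l1Dist_comm]
    exact l1Dist_fHat_deleteNode_le D G₁ hv

theorem exists_reachable_verts_eq_empty (G : LabeledGraph L) :
    ∃ G' : LabeledGraph L, G'.verts = ∅ ∧ (nodeNeighborGraph L).Reachable G G' := by
  induction hn : G.verts.card generalizing G with
  | zero => exact ⟨G, Finset.card_eq_zero.1 hn, .rfl⟩
  | succ n ih =>
    obtain ⟨v, hv⟩ := Finset.card_pos.1 (hn.symm ▸ n.succ_pos : 0 < G.verts.card)
    obtain ⟨G', h0, h⟩ := ih (G.deleteNode v) (by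
      change (G.verts.erase v).card = n
      rw [Finset.card_erase_of_mem hv, hn, Nat.add_sub_cancel])
    have hadj : (nodeNeighborGraph L).Adj G (G.deleteNode v) := Or.inr ⟨v, hv, rfl⟩
    exact ⟨G', h0, hadj.reachable.trans h⟩

/-- Any two graphs are linked through the empty graph. This matters because `SimpleGraph.dist` is
`0` on unreachable pairs, which would break the Lipschitz bounds. -/
theorem nodeNeighborGraph_reachable (G₁ G₂ : LabeledGraph L) :
    (nodeNeighborGraph L).Reachable G₁ G₂ := by
  obtain ⟨⟨s₁, g₁⟩, h₁, r₁⟩ := exists_reachable_verts_eq_empty G₁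
  obtain ⟨⟨s₂, g₂⟩, h₂, r₂⟩ := exists_reachable_verts_eq_empty G₂
  simp only at h₁ h₂
  subst h₁ h₂
  have : g₁ = g₂ := by
    ext u
    exact absurd u.2 (Finset.notMem_empty _)
  subst this
  exact r₁.trans r₂.symm

theorem l1Dist_fHat_le_length (D : ℕ) {G₁ G₂ : LabeledGraph L}
    (p : (nodeNeighborGraph L).Walk G₁ G₂) :
    l1Dist (fHat D G₁) (fHat D G₂) ≤ 3 * (D : ℝ) * p.length := by
  induction p with
  | nil => simp [l1Dist_self]
  | cons h p ih =>
    refine (l1Dist_triangle _ _ _).trans ((add_le_add (l1Dist_fHat_le D h) ih).trans_eq ?_)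
    rw [SimpleGraph.Walk.length_cons]
    push_cast
    ring

theorem isLipschitzOn_fHat (D : ℕ) :
    IsLipschitzOn nodeDist l1Dist (3 * (D : ℝ)) Set.univ (fHat (L := L) D) := by
  intro G₁ _ G₂ _
  obtain ⟨p, hp⟩ := (nodeNeighborGraph_reachable G₁ G₂).exists_walk_length_eq_dist
  rw [nodeDist, ← hp]
  exact l1Dist_fHat_le_length D p

end Sensitivity

/-! ### The optimal Lipschitz constant of the degree list -/

section DegList

variable {L : Type*}

/-- Adjacency as a relation on the labels. -/
def LabeledGraph.LabelAdj (G : LabeledGraph L) (u w : L) : Prop :=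
  ∃ (hu : u ∈ G.verts) (hw : w ∈ G.verts), G.graph.Adj ⟨u, hu⟩ ⟨w, hw⟩

theorem LabeledGraph.labelAdj_comm (G : LabeledGraph L) (u w : L) :
    G.LabelAdj u w ↔ G.LabelAdj w u :=
  ⟨fun ⟨hu, hw, h⟩ => ⟨hw, hu, h.symm⟩, fun ⟨hu, hw, h⟩ => ⟨hw, hu, h.symm⟩⟩

theorem LabeledGraph.labelAdj_deleteNode [DecidableEq L] (G : LabeledGraph L) {u v w : L}
    (hu : u ≠ v) (hw : w ≠ v) : (G.deleteNode v).LabelAdj u w ↔ G.LabelAdj u w :=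
  ⟨fun ⟨hu, hw, h⟩ => ⟨Finset.mem_of_mem_erase hu, Finset.mem_of_mem_erase hw, h⟩,
    fun ⟨hu', hw', h⟩ => ⟨Finset.mem_erase.2 ⟨hu, hu'⟩, Finset.mem_erase.2 ⟨hw, hw'⟩, h⟩⟩

/-- The labels that are never removed along a walk span the same subgraph of both ends. -/
theorem exists_common_of_walk [DecidableEq L] {G₁ G₂ : LabeledGraph L}
    (p : (nodeNeighborGraph L).Walk G₁ G₂) :
    ∃ S : Finset L, S ⊆ G₁.verts ∧ S ⊆ G₂.verts ∧
      (∀ u ∈ S, ∀ w ∈ S, (G₁.LabelAdj u w ↔ G₂.LabelAdj u w)) ∧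
      (G₁.verts \ S).card + (G₂.verts \ S).card ≤ p.length := by
  induction p with
  | nil => exact ⟨_, subset_rfl, subset_rfl, fun _ _ _ _ => Iff.rfl, by simp⟩
  | @cons G₁ G G₂ h p ih =>
    obtain ⟨S, hS, hS₂, hadj, hcard⟩ := ih
    rw [SimpleGraph.Walk.length_cons]
    rcases h with ⟨v, hv, rfl⟩ | ⟨v, hv, rfl⟩
    -- This step inserts `v`, which is absent from the starting graph, so `v` must leave the common
    -- set even if it survives to the end.
    · refine ⟨S.erase v, Finset.erase_subset_erase v hS, (Finset.erase_subset _ _).trans hS₂,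
        fun u hu w hw => ?_, ?_⟩
      · rw [G.labelAdj_deleteNode (Finset.ne_of_mem_erase hu) (Finset.ne_of_mem_erase hw)]
        exact hadj u (Finset.mem_of_mem_erase hu) w (Finset.mem_of_mem_erase hw)
      · have h1 : ((G.deleteNode v).verts \ S.erase v).card ≤ (G.verts \ S).card := by
          refine Finset.card_le_card fun u hu => ?_
          have hu' : u ∈ G.verts.erase v \ S.erase v := hu
          simp only [Finset.mem_sdiff, Finset.mem_erase] at hu' ⊢
          tauto
        have h2 : (G₂.verts \ S.erase v).card ≤ (G₂.verts \ S).card + 1 := by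
          refine (Finset.card_le_card fun u hu => ?_).trans (Finset.card_insert_le v _)
          simp only [Finset.mem_sdiff, Finset.mem_erase, Finset.mem_insert] at hu ⊢
          tauto
        omega
    · have hvS : ∀ u ∈ S, u ≠ v := fun u hu => Finset.ne_of_mem_erase (hS hu)
      refine ⟨S, hS.trans (Finset.erase_subset _ _), hS₂, fun u hu w hw => ?_, ?_⟩
      · rw [← hadj u hu w hw, G₁.labelAdj_deleteNode (hvS u hu) (hvS w hw)]
      · have h1 : (G₁.verts \ S).card ≤ ((G₁.deleteNode v).verts \ S).card + 1 := by
          refine (Finset.card_le_card fun u hu => ?_).trans (Finset.card_insert_le v _)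
          change u ∈ insert v (G₁.verts.erase v \ S)
          simp only [Finset.mem_sdiff, Finset.mem_erase, Finset.mem_insert] at hu ⊢
          tauto
        omega

open scoped Classical in
theorem l1Dist_degList_le [DecidableEq L] {D : ℕ} {G : LabeledGraph L} (hG : G ∈ boundedGraphs L D)
    {S : Finset L} (hS : S ⊆ G.verts) :
    l1Dist (sortDesc fun u : S => ∑ w : S, if G.LabelAdj u w then (1 : ℝ) else 0) (degList G) ≤
      2 * (D : ℝ) * (G.verts \ S).card := by
  set A : L → L → ℝ := fun u w => if G.LabelAdj u w then 1 else 0 with hA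
  have A0 : ∀ u w, 0 ≤ A u w := fun u w => by
    simp only [hA]
    split_ifs <;> norm_num
  have Asymm : ∀ u w, A u w = A w u := fun u w => by simp only [hA, G.labelAdj_comm]
  have hadj : ∀ u : G.verts, ∑ w, adjCap G.graph u w = ∑ w ∈ G.verts, A u w := fun u => by
    rw [← Finset.sum_coe_sort G.verts]
    refine Finset.sum_congr rfl fun w _ => ?_
    have : G.LabelAdj u w ↔ G.graph.Adj u w := ⟨fun ⟨_, _, h⟩ => h, fun h => ⟨u.2, w.2, h⟩⟩
    simp only [hA, adjCap, this]
  have hdeg : ∀ u ∈ G.verts, ∑ w ∈ G.verts, A u w ≤ D := fun u hu =>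
    (hadj ⟨u, hu⟩).symm.trans_le (sum_adjCap_le hG _)
  have hx : ∀ u : L, (∑ w : S, if G.LabelAdj u w then (1 : ℝ) else 0) = ∑ w ∈ S, A u w := fun u =>
    Finset.sum_coe_sort S fun w => A u w
  rw [degList_eq]
  simp only [hx, hadj]
  rw [l1Dist_sortDesc_of_le (φ := fun u : S => (⟨u.1, hS u.2⟩ : G.verts))
    (fun a b hab => Subtype.ext (Subtype.mk.inj hab))
    (fun u => Finset.sum_le_sum_of_subset_of_nonneg hS fun w _ _ => A0 u w)
    (fun u => Finset.sum_nonneg fun w _ => A0 u w),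
    Finset.sum_coe_sort G.verts fun u => ∑ w ∈ G.verts, A u w,
    Finset.sum_coe_sort S fun u => ∑ w ∈ S, A u w, ← Finset.sum_sdiff hS]
  -- Passing to `S` loses the degrees of the removed vertices (`h1`) and the edge ends in `S`
  -- pointing to them (`h3`); each is at most `D` per removed vertex.
  have h1 : ∑ u ∈ G.verts \ S, ∑ w ∈ G.verts, A u w ≤ (G.verts \ S).card * (D : ℝ) := by
    rw [← nsmul_eq_mul]
    exact Finset.sum_le_card_nsmul _ _ _ fun u hu => hdeg u (Finset.mem_sdiff.1 hu).1
  have h2 : ∑ u ∈ S, ∑ w ∈ G.verts, A u w = ∑ u ∈ S, ∑ w ∈ G.verts \ S, A u w +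
      ∑ u ∈ S, ∑ w ∈ S, A u w := by
    rw [← Finset.sum_add_distrib]
    exact Finset.sum_congr rfl fun u _ => (Finset.sum_sdiff hS).symm
  have h3 : ∑ u ∈ S, ∑ w ∈ G.verts \ S, A u w ≤ (G.verts \ S).card * (D : ℝ) := by
    rw [Finset.sum_comm, ← nsmul_eq_mul]
    refine Finset.sum_le_card_nsmul _ _ _ fun w hw => ?_
    refine le_trans ?_ (hdeg w (Finset.mem_sdiff.1 hw).1)
    rw [Finset.sum_congr rfl fun u _ => Asymm u w]
    exact Finset.sum_le_sum_of_subset_of_nonneg hS fun u _ _ => A0 _ _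
  linarith

theorem isLipschitzOn_degList [DecidableEq L] (D : ℕ) :
    IsLipschitzOn nodeDist l1Dist (2 * (D : ℝ)) (boundedGraphs L D) degList := by
  classical
  intro G₁ h₁ G₂ h₂
  obtain ⟨p, hp⟩ := (nodeNeighborGraph_reachable G₁ G₂).exists_walk_length_eq_dist
  -- A shortest walk may leave the bounded graphs, so the estimate cannot be made step by step. Both
  -- ends are compared with their common subgraph on `S` instead.
  obtain ⟨S, hS₁, hS₂, hadj, hcard⟩ := exists_common_of_walk p
  have e₁ := l1Dist_degList_le h₁ hS₁
  have e₂ := l1Dist_degList_le h₂ hS₂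
  have hsame : (fun u : S => ∑ w : S, if G₁.LabelAdj u w then (1 : ℝ) else 0) =
      fun u : S => ∑ w : S, if G₂.LabelAdj u w then (1 : ℝ) else 0 :=
    funext fun u => Finset.sum_congr rfl fun w _ => by simp only [hadj u u.2 w w.2]
  rw [hsame, l1Dist_comm] at e₁
  refine (l1Dist_triangle _ _ _).trans ((add_le_add e₁ e₂).trans ?_)
  rw [nodeDist, ← hp, ← mul_add]
  exact mul_le_mul_of_nonneg_left (by exact_mod_cast hcard) (by positivity)

theorem degList_top (s : Finset L) :
    degList ⟨s, ⊤⟩ = sortDesc fun _ : s => ((s.card - 1 : ℕ) : ℝ) := by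
  classical
  refine congrArg sortDesc (funext fun v => ?_)
  rw [← Fintype.card_coe s, ← SimpleGraph.complete_graph_degree v]
  congr!

/-- Removing a node from the complete graph on `D + 1` nodes shows that the Lipschitz constant
of the degree list is at least `2 * D`. -/
theorem two_mul_le_of_isLipschitzOn_degList [DecidableEq L] [Infinite L] {D : ℕ} {c : ℝ}
    (h : IsLipschitzOn nodeDist l1Dist c (boundedGraphs L D) degList) : 2 * (D : ℝ) ≤ c := by
  classical
  obtain ⟨s, hs⟩ := Infinite.exists_subset_card_eq L (D + 1)
  obtain ⟨v, hv⟩ := Finset.card_pos.1 (hs.symm ▸ D.succ_pos : 0 < s.card)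
  have hcard : (s.erase v).card = D := by rw [Finset.card_erase_of_mem hv, hs, Nat.add_sub_cancel]
  have hbdd : ∀ G : LabeledGraph L, G.verts.card ≤ D + 1 → G ∈ boundedGraphs L D := by
    intro G hG u
    refine Nat.lt_succ_iff.1 ((SimpleGraph.degree_lt_card_verts u).trans_le ?_)
    rwa [Fintype.card_coe]
  have hdel : (⟨s, ⊤⟩ : LabeledGraph L).deleteNode v = ⟨s.erase v, ⊤⟩ := by
    unfold LabeledGraph.deleteNode
    congr 1
    ext a b
    simp only [SimpleGraph.comap_adj, SimpleGraph.top_adj, ne_eq, Subtype.ext_iff]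
  have hadj : (nodeNeighborGraph L).Adj ⟨s.erase v, ⊤⟩ ⟨s, ⊤⟩ := Or.inl ⟨v, hv, hdel.symm⟩
  have hdist : nodeDist (⟨s.erase v, ⊤⟩ : LabeledGraph L) ⟨s, ⊤⟩ = 1 := by
    rw [nodeDist, SimpleGraph.dist_eq_one_iff_adj.2 hadj, Nat.cast_one]
  have key := h _ (hbdd ⟨s.erase v, ⊤⟩ (hcard.trans_le D.le_succ)) _ (hbdd ⟨s, ⊤⟩ hs.le)
  rw [hdist, mul_one, degList_top, degList_top, l1Dist_sortDesc_of_le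
    (φ := fun u : s.erase v => (⟨u.1, Finset.mem_of_mem_erase u.2⟩ : s))
    (fun a b hab => Subtype.ext (Subtype.mk.inj hab))
    (fun u => by
      exact Nat.cast_le.2 (Nat.sub_le_sub_right (Finset.card_le_card (Finset.erase_subset v s)) 1))
    (fun u => Nat.cast_nonneg _)] at key
  simp only [Finset.sum_const, Finset.card_univ, Fintype.card_coe, hs, hcard, nsmul_eq_mul,
    Nat.add_sub_cancel] at key
  -- Here `key` reads `(D + 1) * D - D * (D - 1) ≤ c`, with truncated `D - 1`; the case split
  -- removes the truncation.
  rcases D with _ | D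
  · simpa using key
  · push_cast [Nat.add_sub_cancel] at key ⊢
    linarith

end DegList

end DegreeExtension

theorem theorem3p3 {L : Type*} [DecidableEq L] [Infinite L] (D : ℕ) :
    -- the minimization problem has a solution, the solution is unique on the edges leaving the
    -- source and entering the sink, and `fHat` is its sorted list of flows
    (∀ G : LabeledGraph L,
      (∃ f, IsPhiOptimal D G.graph f) ∧
      (∀ f g, IsPhiOptimal D G.graph f → IsPhiOptimal D G.graph g →
        outFlow f = outFlow g ∧ inFlow f = inFlow g) ∧
      (∀ f, IsPhiOptimal D G.graph f →
        fHat D G = sortDesc (outFlow f) ∧ fHat D G = sortDesc (inFlow f))) ∧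
    -- agreement with the degree list on `D`-bounded graphs
    (∀ G ∈ boundedGraphs L D, fHat D G = degList G) ∧
    -- sensitivity on all pairs of node neighbors
    (∀ G₁ G₂ : LabeledGraph L, NodeNeighbors G₁ G₂ →
      l1Dist (fHat D G₁) (fHat D G₂) ≤ 3 * (D : ℝ)) ∧
    -- Lipschitz extension of stretch `3 / 2`, whatever Lipschitz constant of `degList` is used
    IsLipschitzOn nodeDist l1Dist (2 * (D : ℝ)) (boundedGraphs L D) degList ∧
    (∀ c : ℝ, 0 < c → IsLipschitzOn nodeDist l1Dist c (boundedGraphs L D) degList →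
      IsLipschitzExtension nodeDist l1Dist (boundedGraphs L D) c (3 / 2) degList (fHat D)) := by
  refine ⟨fun G => ⟨exists_isPhiOptimal D G.graph, fun f g => IsPhiOptimal.unique, fun f hf =>
      ⟨fHat_eq hf, hf.outFlow_eq_inFlow ▸ fHat_eq hf⟩⟩, fun G => fHat_eq_degList,
    fun G₁ G₂ => l1Dist_fHat_le D, isLipschitzOn_degList D, fun c hc h => ?_⟩
  refine ⟨hc, by norm_num, h, fun G => fHat_eq_degList, fun G₁ h₁ G₂ h₂ => ?_⟩
  refine (isLipschitzOn_fHat D G₁ h₁ G₂ h₂).trans ?_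
  refine mul_le_mul_of_nonneg_right ?_ (Nat.cast_nonneg _)
  -- Every admissible `c` is at least `2 * D`, hence `3 * D ≤ 3 / 2 * c`.
  linarith [two_mul_le_of_isLipschitzOn_degList h]
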